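/- Let $1\le r\le p$, let $Z$ be a fixed $p\times r$ real matrix with linearly independent columns, $E$ the span of its columns, and $0\le a\le 1$. For each sample size $n$ let independent $\{0,1\}$-valued responses $Y_1,\dots,Y_n$ be observed at given predictor vectors $\mathbf{x}_1,\dots,\mathbf{x}_n\in\mathbb{R}^p$ (which may depend on $n$), following the multiple logistic model $P(Y_i=1)=p(\mathbf{x}_i)$, where $p(\mathbf{x})=1/[1+\exp(-\mathbf{x}'\beta)]$ with the same $\beta\in\mathbb{R}^p$ for all $n$. Let $F=F_n$ be the Fisher information matrix of the sample at $\beta$ and let $\hat\beta=\hat\beta_n$ be the maximum likelihood estimator. Assume that $\hat\beta$ is asymptotically $N_p(\beta,F^{-1})$, that is, $F_n$ is positive definite for all large $n$ and $F_n^{1/2}(\hat\beta_n-\beta)$ converges in distribution to $N_p(0,I_p)$. Let $$\mathscr{X}=\mathscr{X}_n=\{\mathbf{x}\in\mathbb{R}^p:\ \mathbf{x}'F^{-1}Z(Z'F^{-1}Z)^{-1}Z'F^{-1}\mathbf{x}\ \ge\ a^2\,\mathbf{x}'F^{-1}\mathbf{x}\}.$$ For $\mathbf{x}\ne 0$ the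 condition reads $\rho(\mathbf{x},E)\ge a$, where $\rho(\mathbf{x},E)=\{\mathbf{x}'F^{-1}Z(Z'F^{-1}Z)^{-1}Z'F^{-1}\mathbf{x}/\mathbf{x}'F^{-1}\mathbf{x}\}^{1/2}$. Let $F_{\chi}$ and $f_{\chi}$ be the distribution function and density of the $\chi^2_p$ distribution, $H$ the distribution function of the beta$(r/2,(p-r)/2)$ distribution (the point mass at $1$ if $r=p$), and $m(t)=\{at-[(1-a^2)(1-t^2)]^{1/2}\}^2$ for $0\le t\le 1$. Then there is a random variable $G\ge 0$ whose distribution function is, for $g\ge 0$, $$P(G\le g)=F_{\chi}(g)+\int_g^{g/(1-a^2)}H\bigl(m(\sqrt{g/w})\bigr)f_{\chi}(w)\,dw,$$ the upper limit being $\infty$ if $a=1$. Moreover, if $0<\alpha<1$ and $c_\alpha\ge 0$ satisfies $P(G\le c_\alpha^2)=1-\alpha$, then the bands $$\mathbf{x}'\beta\in\mathbf{x}'\hat\beta\pm c_\alpha(\mathbf{x}'F^{-1}\mathbf{x})^{1/2}$$ and $$\{1+\exp[-\mathbf{x}'\hat\beta+c_\alpha(\mathbf{x}'F^{-1}\mathbf{x})^{1/2}]\}^{-1}\le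 p(\mathbf{x})\le\{1+\exp[-\mathbf{x}'\hat\beta-c_\alpha(\mathbf{x}'F^{-1}\mathbf{x})^{1/2}]\}^{-1}$$ are large-sample $100(1-\alpha)\%$ simultaneous confidence bands over $\mathscr{X}$: for each of the two, the probability that the band holds for all $\mathbf{x}\in\mathscr{X}$ tends to $1-\alpha$ as $n\to\infty$. -/

import Mathlib

open MeasureTheory ProbabilityTheory Filter Topology Matrix
open scoped MatrixOrder

namespace LogisticBand

noncomputable section

/-! ### The multiple logistic model -/

/-- Response probability `p(x) = 1 / (1 + exp (-x'b))`. -/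
def responseProb {p : ℕ} (b x : Fin p → ℝ) : ℝ :=
  1 / (1 + Real.exp (-(x ⬝ᵥ b)))

/-- `Y 0, …, Y (n-1)` are independent responses with values in `{0, 1}`, observed at the
predictor vectors `X 0, …, X (n-1)`, that follow the logistic model with parameter `β`. -/
structure IsLogisticSample {p n : ℕ} {Ω : Type*} [MeasurableSpace Ω] (P : Measure Ω)
    (β : Fin p → ℝ) (X : Fin n → Fin p → ℝ) (Y : Fin n → Ω → ℝ) : Prop where
  measurable : ∀ i, Measurable (Y i)
  zero_or_one : ∀ i ω, Y i ω = 0 ∨ Y i ω = 1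
  indep : iIndepFun Y P
  prob_one : ∀ i, P.real {ω | Y i ω = 1} = responseProb β (X i)

/-- Log-likelihood at the parameter `b` of the responses `y` observed at `X`. -/
def logLik {p n : ℕ} (X : Fin n → Fin p → ℝ) (y : Fin n → ℝ) (b : Fin p → ℝ) : ℝ :=
  ∑ i, (y i * Real.log (responseProb b (X i)) + (1 - y i) * Real.log (1 - responseProb b (X i)))

/-- `est` is a maximum likelihood estimator: it maximizes the likelihood for every data set
for which a maximizer exists (for separated data there is none). -/
def IsMLE {p n : ℕ} {Ω : Type*} (X : Fin n → Fin p → ℝ) (Y : Fin n → Ω → ℝ)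
    (est : Ω → Fin p → ℝ) : Prop :=
  ∀ ω, (∃ b, ∀ b', logLik X (fun i => Y i ω) b' ≤ logLik X (fun i => Y i ω) b) →
    ∀ b', logLik X (fun i => Y i ω) b' ≤ logLik X (fun i => Y i ω) (est ω)

/-- `j`-th coordinate of the score, `∂ logLik / ∂ b_j`. -/
def score {p n : ℕ} (X : Fin n → Fin p → ℝ) (y : Fin n → ℝ) (b : Fin p → ℝ) (j : Fin p) : ℝ :=
  fderiv ℝ (logLik X y) b (Pi.single j 1)

/-- Fisher information matrix of the sample at `β`: the second moment matrix of the score. -/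
def fisherInfo {p n : ℕ} {Ω : Type*} [MeasurableSpace Ω] (P : Measure Ω)
    (β : Fin p → ℝ) (X : Fin n → Fin p → ℝ) (Y : Fin n → Ω → ℝ) : Matrix (Fin p) (Fin p) ℝ :=
  Matrix.of fun j k =>
    ∫ ω, score X (fun i => Y i ω) β j * score X (fun i => Y i ω) β k ∂P

/-- `est n` is asymptotically `N_p(β, (F n)⁻¹)`: the matrices `F n` are eventually positive
definite, and `(F n)^{1/2} (est n - β)` converges in distribution to `N_p(0, I)`. -/
def IsAsympNormal {p : ℕ} {Ω : ℕ → Type*} [∀ n, MeasurableSpace (Ω n)]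
    (P : ∀ n, Measure (Ω n)) [∀ n, IsProbabilityMeasure (P n)] (β : Fin p → ℝ)
    (F : ℕ → Matrix (Fin p) (Fin p) ℝ) (est : ∀ n, Ω n → Fin p → ℝ) : Prop :=
  (∀ᶠ n in atTop, (F n).PosDef) ∧
  TendstoInDistribution
    (fun n ω => (WithLp.toLp 2 (CFC.sqrt (F n) *ᵥ (est n ω - β)) : EuclideanSpace ℝ (Fin p)))
    atTop (id : EuclideanSpace ℝ (Fin p) → EuclideanSpace ℝ (Fin p)) P
    (stdGaussian (EuclideanSpace ℝ (Fin p)))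

/-! ### The constraint region and the bands -/

/-- The quadratic form `x'F⁻¹x`. -/
def quadInv {p : ℕ} (F : Matrix (Fin p) (Fin p) ℝ) (x : Fin p → ℝ) : ℝ :=
  x ⬝ᵥ (F⁻¹ *ᵥ x)

/-- The quadratic form `x'F⁻¹Z(Z'F⁻¹Z)⁻¹Z'F⁻¹x`. -/
def quadProj {p r : ℕ} (F : Matrix (Fin p) (Fin p) ℝ) (Z : Matrix (Fin p) (Fin r) ℝ)
    (x : Fin p → ℝ) : ℝ :=
  x ⬝ᵥ ((F⁻¹ * Z * (Zᵀ * F⁻¹ * Z)⁻¹ * Zᵀ * F⁻¹) *ᵥ x)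

/-- The multiple correlation coefficient `ρ(x, E)`, `E` the column span of `Z`. -/
def rho {p r : ℕ} (F : Matrix (Fin p) (Fin p) ℝ) (Z : Matrix (Fin p) (Fin r) ℝ)
    (x : Fin p → ℝ) : ℝ :=
  Real.sqrt (quadProj F Z x / quadInv F x)

/-- The constraint region. -/
def region {p r : ℕ} (F : Matrix (Fin p) (Fin p) ℝ) (Z : Matrix (Fin p) (Fin r) ℝ)
    (a : ℝ) : Set (Fin p → ℝ) :=
  {x | a ^ 2 * quadInv F x ≤ quadProj F Z x}

/-- Away from the origin, where `ρ` is undefined, the region is `{x | ρ(x, E) ≥ a}`. -/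
theorem mem_region_iff {p r : ℕ} {F : Matrix (Fin p) (Fin p) ℝ} (hF : F.PosDef)
    (Z : Matrix (Fin p) (Fin r) ℝ) {a : ℝ} (ha : 0 ≤ a) {x : Fin p → ℝ} (hx : x ≠ 0) :
    x ∈ region F Z a ↔ a ≤ rho F Z x := by
  have hpos : 0 < quadInv F x := by
    simpa [quadInv] using hF.inv.dotProduct_mulVec_pos hx
  have key : a ^ 2 ≤ quadProj F Z x / quadInv F x ↔ x ∈ region F Z a := by
    rw [le_div_iff₀ hpos]; rfl
  have hB : (F⁻¹ * Z)ᴴ = Zᵀ * F⁻¹ := by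
    rw [conjTranspose_mul, hF.inv.isHermitian.eq, conjTranspose_eq_transpose_of_trivial]
  have hS : (Zᵀ * F⁻¹ * Z).PosSemidef := by
    simpa [conjTranspose_eq_transpose_of_trivial] using
      hF.inv.posSemidef.conjTranspose_mul_mul_same Z
  have hproj : 0 ≤ quadProj F Z x := by
    have h := (hS.inv.mul_mul_conjTranspose_same (F⁻¹ * Z)).dotProduct_mulVec_nonneg x
    rw [hB] at h
    simpa [quadProj, Matrix.mul_assoc] using h
  rw [← key, rho, Real.le_sqrt ha]
  exact div_nonneg hproj hpos.le

/-- The band for the linear predictor, computed from the estimate `b`, contains `x'β` for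
all `x` in `S`. -/
def LinearBandCovers {p : ℕ} (F : Matrix (Fin p) (Fin p) ℝ) (S : Set (Fin p → ℝ)) (c : ℝ)
    (β b : Fin p → ℝ) : Prop :=
  ∀ x ∈ S, x ⬝ᵥ β ∈ Set.Icc (x ⬝ᵥ b - c * Real.sqrt (quadInv F x))
    (x ⬝ᵥ b + c * Real.sqrt (quadInv F x))

/-- The band for the response probability, computed from the estimate `b`, contains `p(x)` for
all `x` in `S`. -/
def ProbBandCovers {p : ℕ} (F : Matrix (Fin p) (Fin p) ℝ) (S : Set (Fin p → ℝ)) (c : ℝ)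
    (β b : Fin p → ℝ) : Prop :=
  ∀ x ∈ S, responseProb β x ∈ Set.Icc
    (1 + Real.exp (-(x ⬝ᵥ b) + c * Real.sqrt (quadInv F x)))⁻¹
    (1 + Real.exp (-(x ⬝ᵥ b) - c * Real.sqrt (quadInv F x)))⁻¹

/-! ### The distribution function that gives the critical value -/

/-- The chi-square distribution with `p` degrees of freedom. -/
def chiSq (p : ℕ) : Measure ℝ := gammaMeasure ((p : ℝ) / 2) (1 / 2)

/-- Density of the chi-square distribution with `p` degrees of freedom. -/
def chiSqDensity (p : ℕ) (w : ℝ) : ℝ := gammaPDFReal ((p : ℝ) / 2) (1 / 2) w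

/-- The distribution beta(`r / 2`, `(p - r) / 2`), which for `r = p` is the point mass at `1`. -/
def betaHalf (r p : ℕ) : Measure ℝ :=
  if r = p then Measure.dirac 1 else betaMeasure ((r : ℝ) / 2) (((p : ℝ) - r) / 2)

/-- `m(t) = (a t - ((1 - a²)(1 - t²))^{1/2})²`. -/
def mFun (a t : ℝ) : ℝ :=
  (a * t - Real.sqrt ((1 - a ^ 2) * (1 - t ^ 2))) ^ 2

/-- `F(g) + ∫_g^{g/(1-a²)} H(m(√(g/w))) f(w) dw`; the upper limit is `∞` if `a = 1`. -/
def critCDF (p r : ℕ) (a g : ℝ) : ℝ :=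
  cdf (chiSq p) g +
    if a = 1 then
      ∫ w in Set.Ioi g, cdf (betaHalf r p) (mFun a (Real.sqrt (g / w))) * chiSqDensity p w
    else
      ∫ w in g..(g / (1 - a ^ 2)),
        cdf (betaHalf r p) (mFun a (Real.sqrt (g / w))) * chiSqDensity p w

end

end LogisticBand

open LogisticBand

/-!
Write the bands in the coordinates `u = F^{-1/2} x` and `z = F^{1/2} (b - β)`: both hold over the
region iff `|⟪u, z⟫| ≤ c ‖u‖` for every `u` within the angle `A = arccos a` of the subspace
`K = F^{-1/2} (span Z)`. If `θ` is the angle between `z` and `K`, the largest value of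
`|⟪u, z⟫| / ‖u‖` is `‖z‖ cos (max (θ - A) 0)`. For a standard Gaussian `z`, the variables `‖z‖²`
and `cos² θ` are independent with laws `χ²_p` and beta(`r / 2`, `(p - r) / 2`), so the law of the
square of that maximum depends only on `p`, `r` and `a`; its distribution function is the given one
because `m(t) = cos² (A + arccos t)`.

The subspaces `K` vary with `n` and need not converge. They are images of one fixed subspace under
isometries; these form a compact set and preserve the Gaussian law, so every limit point of the
laws of the maximum is the same.
-/

namespace LogisticBand

open scoped ENNReal

/-! ### Gamma, beta and chi-square distributions -/

theorem measurable_gammaPDF (α ρ : ℝ) : Measurable (gammaPDF α ρ) :=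
  (measurable_gammaPDFReal α ρ).ennreal_ofReal

theorem measurable_betaPDF (α β : ℝ) : Measurable (betaPDF α β) :=
  (measurable_betaPDFReal α β).ennreal_ofReal

theorem lintegral_gammaMeasure (α ρ : ℝ) {f : ℝ → ℝ≥0∞} (hf : Measurable f) :
    ∫⁻ x, f x ∂(gammaMeasure α ρ) = ∫⁻ x, gammaPDF α ρ x * f x :=
  lintegral_withDensity_eq_lintegral_mul _ (measurable_gammaPDF α ρ) hf

theorem lintegral_betaMeasure (α β : ℝ) {f : ℝ → ℝ≥0∞} (hf : Measurable f) :
    ∫⁻ x, f x ∂(betaMeasure α β) = ∫⁻ x, betaPDF α β x * f x :=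
  lintegral_withDensity_eq_lintegral_mul _ (measurable_betaPDF α β) hf

theorem lintegral_eq_mul_lintegral_comp_mul {f : ℝ → ℝ≥0∞} (hf : Measurable f) {w : ℝ}
    (hw : 0 < w) : ∫⁻ s, f s = ENNReal.ofReal w * ∫⁻ b, f (w * b) := by
  have h := lintegral_map (μ := volume) hf (measurable_const_mul w)
  rw [Real.map_volume_mul_left hw.ne', lintegral_smul_measure, smul_eq_mul] at h
  rw [← h, ← mul_assoc, ← ENNReal.ofReal_mul hw.le, abs_of_pos (inv_pos.2 hw),
    mul_inv_cancel₀ hw.ne', ENNReal.ofReal_one, one_mul]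

theorem mul_gammaPDFReal_mul_gammaPDFReal {α β ρ : ℝ} (hα : 0 < α) (hβ : 0 < β) (hρ : 0 < ρ)
    {w b : ℝ} (hw : 0 < w) (hb0 : 0 < b) (hb1 : b < 1) :
    w * (gammaPDFReal α ρ (w * b) * gammaPDFReal β ρ (w * (1 - b))) =
      gammaPDFReal (α + β) ρ w * betaPDFReal α β b := by
  have hb : 0 < 1 - b := sub_pos.2 hb1
  have := Real.Gamma_pos_of_pos hα
  have := Real.Gamma_pos_of_pos hβ
  have := Real.Gamma_pos_of_pos (add_pos hα hβ)
  have hexp : Real.exp (-(ρ * w)) =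
      Real.exp (-(ρ * (w * b))) * Real.exp (-(ρ * (w * (1 - b)))) := by
    rw [← Real.exp_add]; congr 1; ring
  have hpow : w ^ (α + β - 1) = w * (w ^ (α - 1) * w ^ (β - 1)) := by
    rw [← Real.rpow_add hw, mul_comm, ← Real.rpow_add_one hw.ne']; congr 1; ring
  rw [gammaPDFReal, gammaPDFReal, gammaPDFReal, betaPDFReal, if_pos (by positivity),
    if_pos (by positivity), if_pos hw.le, if_pos ⟨hb0, hb1⟩, Real.mul_rpow hw.le hb0.le,
    Real.mul_rpow hw.le hb.le, hpow, Real.rpow_add hρ, hexp, ProbabilityTheory.beta]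
  field_simp

theorem mul_gammaPDF_mul_gammaPDF {α β ρ : ℝ} (hα : 0 < α) (hβ : 0 < β) (hρ : 0 < ρ) {w b : ℝ}
    (hw : 0 < w) (hb0 : b ≠ 0) (hb1 : b ≠ 1) :
    ENNReal.ofReal w * (gammaPDF α ρ (w * b) * gammaPDF β ρ (w - w * b)) =
      gammaPDF (α + β) ρ w * betaPDF α β b := by
  rcases hb0.lt_or_gt with hb0 | hb0
  · rw [gammaPDF_of_neg (mul_neg_of_pos_of_neg hw hb0), betaPDF_eq_zero_of_nonpos hb0.le,
      zero_mul, mul_zero, mul_zero]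
  rcases hb1.lt_or_gt with hb1 | hb1
  · have hα' := gammaPDFReal_nonneg hα hρ (w * b)
    have hαβ := gammaPDFReal_nonneg (add_pos hα hβ) hρ w
    rw [gammaPDF, gammaPDF, gammaPDF, betaPDF, ← ENNReal.ofReal_mul hα',
      ← ENNReal.ofReal_mul hw.le, ← ENNReal.ofReal_mul hαβ, ← mul_one_sub,
      mul_gammaPDFReal_mul_gammaPDFReal hα hβ hρ hw hb0 hb1]
  · rw [gammaPDF_of_neg (x := w - w * b) (by nlinarith), betaPDF_eq_zero_of_one_le hb1.le,
      mul_zero, mul_zero, mul_zero]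

theorem lintegral_gammaPDF_mul_gammaPDF_sub {α β ρ : ℝ} (hα : 0 < α) (hβ : 0 < β) (hρ : 0 < ρ)
    {w : ℝ} (hw : w ≠ 0) {f : ℝ → ℝ≥0∞} (hf : Measurable f) :
    ∫⁻ s, gammaPDF α ρ s * gammaPDF β ρ (w - s) * f (s / w) =
      gammaPDF (α + β) ρ w * ∫⁻ b, f b ∂(betaMeasure α β) := by
  have mα := measurable_gammaPDF α ρ
  have mβ := measurable_gammaPDF β ρ
  have mB := measurable_betaPDF α β
  rcases hw.lt_or_gt with hw | hw
  · rw [gammaPDF_of_neg hw, zero_mul]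
    refine (lintegral_congr fun s => ?_).trans lintegral_zero
    rcases lt_or_ge s 0 with hs | hs
    · rw [gammaPDF_of_neg hs, zero_mul, zero_mul]
    · rw [gammaPDF_of_neg (x := w - s) (by linarith), mul_zero, zero_mul]
  · rw [lintegral_eq_mul_lintegral_comp_mul (by fun_prop) hw, lintegral_betaMeasure _ _ hf,
      ← lintegral_const_mul _ (by fun_prop), ← lintegral_const_mul _ (by fun_prop)]
    refine lintegral_congr_ae ?_
    filter_upwards [Measure.ae_ne volume (0 : ℝ), Measure.ae_ne volume (1 : ℝ)] with b hb0 hb1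
    rw [mul_div_cancel_left₀ _ hw.ne', ← mul_assoc, ← mul_assoc (gammaPDF (α + β) ρ w),
      ← mul_gammaPDF_mul_gammaPDF hα hβ hρ hw hb0 hb1]

theorem map_add_div_add_gamma_prod_gamma {α β ρ : ℝ} (hα : 0 < α) (hβ : 0 < β) (hρ : 0 < ρ) :
    ((gammaMeasure α ρ).prod (gammaMeasure β ρ)).map (fun x => (x.1 + x.2, x.1 / (x.1 + x.2))) =
      (gammaMeasure (α + β) ρ).prod (betaMeasure α β) := by
  have := isProbabilityMeasure_gammaMeasure hα hρ
  have := isProbabilityMeasure_gammaMeasure hβ hρ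
  have := isProbabilityMeasure_gammaMeasure (add_pos hα hβ) hρ
  have := isProbabilityMeasureBeta hα hβ
  have mα := measurable_gammaPDF α ρ
  have mβ := measurable_gammaPDF β ρ
  refine Measure.ext_of_lintegral _ fun f hf => ?_
  have hf' : Measurable fun z : ℝ × ℝ => f (z.1 + z.2, z.1 / (z.1 + z.2)) := by fun_prop
  have shift (s : ℝ) :
      gammaPDF α ρ s * ∫⁻ t, f (s + t, s / (s + t)) ∂(gammaMeasure β ρ) =
        ∫⁻ w, gammaPDF α ρ s * gammaPDF β ρ (w - s) * f (w, s / w) := by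
    rw [lintegral_gammaMeasure _ _ (by fun_prop), ← lintegral_const_mul _ (by fun_prop),
      ← lintegral_sub_right_eq_self _ s]
    simp only [add_sub_cancel, mul_assoc]
  rw [lintegral_map hf (by fun_prop), lintegral_prod _ hf'.aemeasurable,
    lintegral_prod _ hf.aemeasurable, lintegral_gammaMeasure _ _ hf'.lintegral_prod_right',
    lintegral_gammaMeasure _ _ hf.lintegral_prod_right', lintegral_congr shift,
    lintegral_lintegral_swap (by fun_prop)]
  refine lintegral_congr_ae ?_
  filter_upwards [Measure.ae_ne volume (0 : ℝ)] with w hw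
  exact lintegral_gammaPDF_mul_gammaPDF_sub hα hβ hρ hw (f := fun b => f (w, b)) (by fun_prop)

theorem map_add_gamma_prod_gamma {α β ρ : ℝ} (hα : 0 < α) (hβ : 0 < β) (hρ : 0 < ρ) :
    ((gammaMeasure α ρ).prod (gammaMeasure β ρ)).map (fun x => x.1 + x.2) =
      gammaMeasure (α + β) ρ := by
  have := isProbabilityMeasureBeta hα hβ
  have h := congrArg (Measure.map Prod.fst) (map_add_div_add_gamma_prod_gamma hα hβ hρ)
  rwa [Measure.map_map measurable_fst (by fun_prop), Measure.map_fst_prod, measure_univ,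
    one_smul] at h

theorem lintegral_comp_sq (f : ℝ → ℝ≥0∞) :
    ∫⁻ x, f (x ^ 2) = ∫⁻ y in Set.Ioi 0, ENNReal.ofReal (√y)⁻¹ * f y := by
  have reflect : ∫⁻ x in Set.Iic 0, f (x ^ 2) = ∫⁻ x in Set.Ioi 0, f (x ^ 2) := by
    have h := (Measure.measurePreserving_neg (volume : Measure ℝ)).setLIntegral_comp_preimage_emb
      (MeasurableEquiv.neg ℝ).measurableEmbedding (fun x => f (x ^ 2)) (Set.Ioi 0)
    simpa only [Set.neg_preimage, Set.neg_Ioi, neg_zero, neg_sq,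
      setLIntegral_congr Iio_ae_eq_Iic] using h
  have image : (fun y : ℝ => √y) '' Set.Ioi 0 = Set.Ioi 0 := by
    refine Set.Subset.antisymm (Set.image_subset_iff.2 fun y => Real.sqrt_pos.2) fun x hx => ?_
    exact ⟨x ^ 2, pow_pos (Set.mem_Ioi.1 hx) 2, Real.sqrt_sq (le_of_lt hx)⟩
  have subst : ∫⁻ x in Set.Ioi 0, f (x ^ 2) =
      ∫⁻ y in Set.Ioi 0, ENNReal.ofReal |1 / (2 * √y)| * f (√y ^ 2) := by
    conv_lhs => rw [← image]
    exact lintegral_image_eq_lintegral_abs_deriv_mul measurableSet_Ioi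
      (fun y hy => (Real.hasDerivAt_sqrt (ne_of_gt hy)).hasDerivWithinAt)
      (fun x hx y hy => (Real.sqrt_inj (le_of_lt hx) (le_of_lt hy)).1) _
  rw [← lintegral_add_compl _ measurableSet_Ioi, Set.compl_Ioi, reflect, subst, ← two_mul,
    ← lintegral_const_mul' _ _ ENNReal.ofNat_ne_top]
  refine setLIntegral_congr_fun measurableSet_Ioi fun y hy => ?_
  rw [Real.sq_sqrt (le_of_lt hy), ← mul_assoc, ← ENNReal.ofReal_ofNat,
    ← ENNReal.ofReal_mul zero_le_two, abs_of_nonneg (by positivity)]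
  congr 2
  field_simp

theorem gammaPDFReal_half_half_of_pos {y : ℝ} (hy : 0 < y) :
    gammaPDFReal (1 / 2) (1 / 2) y = (√y)⁻¹ * ((√(2 * Real.pi))⁻¹ * Real.exp (-y / 2)) := by
  rw [gammaPDFReal, if_pos hy.le, Real.Gamma_one_half_eq, ← Real.sqrt_eq_rpow,
    show (1 / 2 - 1 : ℝ) = -(1 / 2) by norm_num, Real.rpow_neg hy.le, ← Real.sqrt_eq_rpow,
    Real.sqrt_mul zero_le_two, one_div, Real.sqrt_inv, show -y / 2 = -(2⁻¹ * y) by ring]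
  field_simp

theorem map_sq_gaussianReal :
    (gaussianReal 0 1).map (fun x => x ^ 2) = gammaMeasure (1 / 2) (1 / 2) := by
  refine Measure.ext_of_lintegral _ fun f hf => ?_
  have density (x : ℝ) : gaussianPDF 0 1 x =
      ENNReal.ofReal ((√(2 * Real.pi))⁻¹ * Real.exp (-x ^ 2 / 2)) := by
    simp only [gaussianPDF, gaussianPDFReal, NNReal.coe_one, mul_one, sub_zero]
  have support : ∫⁻ y, gammaPDF (1 / 2) (1 / 2) y * f y =
      ∫⁻ y in Set.Ioi 0, gammaPDF (1 / 2) (1 / 2) y * f y := by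
    rw [setLIntegral_congr Ioi_ae_eq_Ici]
    refine (setLIntegral_eq_of_support_subset fun y hy => ?_).symm
    by_contra hneg
    exact hy (by simp only [gammaPDF_of_neg (not_le.1 hneg), zero_mul])
  rw [lintegral_map hf (by fun_prop), gaussianReal_of_var_ne_zero _ one_ne_zero,
    lintegral_withDensity_eq_lintegral_mul _ (measurable_gaussianPDF 0 1) (by fun_prop),
    lintegral_gammaMeasure _ _ hf, support]
  simp only [Pi.mul_apply, density]
  rw [lintegral_comp_sq fun y =>
    ENNReal.ofReal ((√(2 * Real.pi))⁻¹ * Real.exp (-y / 2)) * f y]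
  refine setLIntegral_congr_fun measurableSet_Ioi fun y hy => ?_
  simp only [gammaPDF]
  rw [gammaPDFReal_half_half_of_pos hy, ENNReal.ofReal_mul (p := (√y)⁻¹) (by positivity),
    mul_assoc]

theorem map_sum_sq_pi_gaussianReal (n : ℕ) :
    (Measure.pi fun _ : Fin (n + 1) => gaussianReal 0 1).map (fun x => ∑ i, x i ^ 2) =
      chiSq (n + 1) := by
  induction n with
  | zero =>
    have h := (measurePreserving_eval (fun _ : Fin 1 => gaussianReal 0 1) 0).map_eq
    have hsq := map_sq_gaussianReal
    rw [← h, Measure.map_map (by fun_prop) (by fun_prop)] at hsq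
    simpa [chiSq, Function.comp_def] using hsq
  | succ n ih =>
    have hcons :=
      (measurePreserving_piFinSuccAbove (fun _ : Fin (n + 2) => gaussianReal 0 1) 0).map_eq
    have hadd := map_add_gamma_prod_gamma (α := 1 / 2) (β := ((n + 1 : ℕ) : ℝ) / 2) (ρ := 1 / 2)
      (by norm_num) (by positivity) (by norm_num)
    rw [← map_sq_gaussianReal, ← chiSq, ← ih, Measure.map_prod_map _ _ (by fun_prop) (by fun_prop),
      Measure.map_map (by fun_prop) (by fun_prop), ← hcons, Measure.map_map (by fun_prop)
        (MeasurableEquiv.measurable _)] at hadd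
    rw [chiSq, show ((n + 1 + 1 : ℕ) : ℝ) / 2 = 1 / 2 + ((n + 1 : ℕ) : ℝ) / 2 by push_cast; ring,
      ← hadd]
    congr 1
    funext x
    rw [Fin.sum_univ_succ]
    rfl

theorem isProbabilityMeasure_chiSq {p : ℕ} (hp : 0 < p) : IsProbabilityMeasure (chiSq p) :=
  isProbabilityMeasure_gammaMeasure (by positivity) (by norm_num)

theorem isProbabilityMeasure_betaHalf {r p : ℕ} (hr : 0 < r) (hrp : r ≤ p) :
    IsProbabilityMeasure (betaHalf r p) := by
  unfold betaHalf
  split_ifs with h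
  · infer_instance
  · have hr' : (0 : ℝ) < r := by exact_mod_cast hr
    have hrp' : (r : ℝ) < p := by exact_mod_cast lt_of_le_of_ne hrp h
    exact isProbabilityMeasureBeta (by linarith) (by linarith)

theorem chiSq_absolutelyContinuous (p : ℕ) : chiSq p ≪ volume :=
  withDensity_absolutelyContinuous _ _

theorem ae_chiSq_nonneg (p : ℕ) : ∀ᵐ w ∂(chiSq p), 0 ≤ w := by
  simp only [ae_iff, not_le]
  exact (withDensity_apply _ measurableSet_Iio).trans (lintegral_gammaPDF_of_nonpos le_rfl)

theorem ae_betaHalf_mem (r p : ℕ) : ∀ᵐ b ∂(betaHalf r p), b ∈ Set.Ioc (0 : ℝ) 1 := by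
  unfold betaHalf
  split_ifs with h
  · exact (ae_dirac_iff measurableSet_Ioc).2 ⟨zero_lt_one, le_rfl⟩
  · rw [betaMeasure, ae_withDensity_iff (measurable_betaPDF _ _)]
    refine ae_of_all _ fun b hb => ?_
    contrapose! hb
    rw [Set.mem_Ioc, not_and_or, not_lt, not_le] at hb
    exact hb.elim betaPDF_eq_zero_of_nonpos fun h => betaPDF_eq_zero_of_one_le h.le

/-! ### The standard Gaussian measure and its projections -/

section StdGaussian

variable {E : Type*} [NormedAddCommGroup E] [InnerProductSpace ℝ E] [FiniteDimensional ℝ E]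
  [MeasurableSpace E] [BorelSpace E]

theorem map_norm_sq_stdGaussian (hE : 0 < Module.finrank ℝ E) :
    (stdGaussian E).map (fun z => ‖z‖ ^ 2) = chiSq (Module.finrank ℝ E) := by
  obtain ⟨n, hn⟩ := Nat.exists_eq_succ_of_ne_zero hE.ne'
  let b := (stdOrthonormalBasis ℝ E).reindex (finCongr hn)
  rw [hn, ← map_sum_sq_pi_gaussianReal, stdGaussian_eq_map_pi_orthonormalBasis b,
    Measure.map_map (by fun_prop) (by fun_prop)]
  congr 1
  funext x
  have hcoord : ∑ i, x i • b i = b.repr.symm (WithLp.toLp 2 x) := b.sum_repr_symm (WithLp.toLp 2 x)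
  rw [Function.comp_apply, hcoord, LinearIsometryEquiv.norm_map, EuclideanSpace.real_norm_sq_eq]

theorem ae_stdGaussian_ne_zero (hE : 0 < Module.finrank ℝ E) : ∀ᵐ z ∂(stdGaussian E), z ≠ 0 := by
  have h : ∀ᵐ w ∂(stdGaussian E).map (fun z => ‖z‖ ^ 2), w ≠ 0 := by
    rw [map_norm_sq_stdGaussian hE]
    exact (chiSq_absolutelyContinuous _).ae_le (Measure.ae_ne volume 0)
  filter_upwards [ae_of_ae_map (by fun_prop) h] with z hz
  exact norm_ne_zero_iff.1 (pow_ne_zero_iff two_ne_zero |>.1 hz)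

theorem map_orthogonalProjectionOnto_stdGaussian (K : Submodule ℝ E) :
    (stdGaussian E).map (fun z => (K.orthogonalProjectionOnto z, Kᗮ.orthogonalProjectionOnto z)) =
      (stdGaussian K).prod (stdGaussian Kᗮ) := by
  refine charFun_eq_prod_iff.1 fun t => ?_
  have hdecomp : (WithLp.toLp 2 ∘ fun z : E =>
      (K.orthogonalProjectionOnto z, Kᗮ.orthogonalProjectionOnto z)) = K.orthogonalDecomposition :=
    funext fun z => (K.orthogonalDecomposition_apply z).symm
  rw [Measure.map_map (by fun_prop) (by fun_prop), hdecomp, stdGaussian_map, charFun_stdGaussian,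
    charFun_stdGaussian, charFun_stdGaussian, ← Complex.exp_add, ← Complex.ofReal_pow,
    WithLp.prod_norm_sq_eq_of_L2, Complex.ofReal_add, Complex.ofReal_pow, Complex.ofReal_pow,
    neg_add, add_div]
  rfl

theorem map_norm_sq_div_stdGaussian {K : Submodule ℝ E} (hK : 0 < Module.finrank ℝ K) :
    (stdGaussian E).map (fun z => (‖z‖ ^ 2, ‖K.starProjection z‖ ^ 2 / ‖z‖ ^ 2)) =
      (chiSq (Module.finrank ℝ E)).prod (betaHalf (Module.finrank ℝ K) (Module.finrank ℝ E)) := by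
  have hE : 0 < Module.finrank ℝ E := hK.trans_le K.finrank_le
  have := isProbabilityMeasure_chiSq hE
  rcases eq_or_ne (Module.finrank ℝ K) (Module.finrank ℝ E) with h | h
  · have hratio : (fun z : E => (‖z‖ ^ 2, ‖K.starProjection z‖ ^ 2 / ‖z‖ ^ 2)) =ᵐ[stdGaussian E]
        (fun w => (w, 1)) ∘ fun z => ‖z‖ ^ 2 := by
      filter_upwards [ae_stdGaussian_ne_zero hE] with z hz
      have hzK : z ∈ K := Submodule.eq_top_of_finrank_eq h ▸ Submodule.mem_top
      rw [Submodule.starProjection_eq_self_iff.2 hzK, div_self (by positivity), Function.comp_apply]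
    rw [Measure.map_congr hratio, ← Measure.map_map (by fun_prop) (by fun_prop),
      map_norm_sq_stdGaussian hE, betaHalf, if_pos h, Measure.prod_dirac]
  · have hperp : Module.finrank ℝ K + Module.finrank ℝ Kᗮ = Module.finrank ℝ E :=
      K.finrank_add_finrank_orthogonal
    have hKperp : 0 < Module.finrank ℝ Kᗮ := by have := K.finrank_le; omega
    have hprod : (stdGaussian E).map (fun z =>
        (‖K.orthogonalProjectionOnto z‖ ^ 2, ‖Kᗮ.orthogonalProjectionOnto z‖ ^ 2)) =
        (chiSq (Module.finrank ℝ K)).prod (chiSq (Module.finrank ℝ Kᗮ)) := by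
      rw [← map_norm_sq_stdGaussian hK, ← map_norm_sq_stdGaussian hKperp,
        Measure.map_prod_map _ _ (by fun_prop) (by fun_prop),
        ← map_orthogonalProjectionOnto_stdGaussian, Measure.map_map (by fun_prop) (by fun_prop)]
      rfl
    rw [betaHalf, if_neg h, chiSq, ← hperp, Nat.cast_add, add_div, add_sub_cancel_left,
      ← map_add_div_add_gamma_prod_gamma (by positivity) (by positivity) (by norm_num), ← chiSq,
      ← chiSq, ← hprod, Measure.map_map (by fun_prop) (by fun_prop)]
    congr 1
    funext z
    rw [Function.comp_apply, ← K.norm_sq_eq_add_norm_sq_projection]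
    rfl

end StdGaussian

/-! ### The critical law -/

/-- The squared cosine `cos² max(θ - A, 0)`, where `a = cos A` and `b = cos² θ`: the largest
fraction of the squared length of a vector at angle `θ` to a subspace that is seen from a
direction within the angle `A` of that subspace. -/
noncomputable def shrink (a b : ℝ) : ℝ :=
  Real.cos (max (Real.arccos √b - Real.arccos a) 0) ^ 2

theorem continuous_shrink (a : ℝ) : Continuous (shrink a) := by
  have := Real.continuous_arccos
  unfold shrink
  fun_prop

theorem shrink_nonneg (a b : ℝ) : 0 ≤ shrink a b :=
  sq_nonneg _

theorem shrink_le_one (a b : ℝ) : shrink a b ≤ 1 :=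
  Real.cos_sq_le_one _

theorem shrink_pos (a : ℝ) {b : ℝ} (hb : 0 < b) : 0 < shrink a b := by
  have h : Real.arccos √b < Real.pi / 2 := Real.arccos_lt_pi_div_two.2 (Real.sqrt_pos.2 hb)
  refine pow_pos (Real.cos_pos_of_mem_Ioo ⟨?_, max_lt ?_ (by positivity)⟩) 2
  · linarith [le_max_right (Real.arccos √b - Real.arccos a) 0, Real.pi_pos]
  · linarith [Real.arccos_nonneg a]

theorem cos_arccos_add_arccos {a t : ℝ} (ha : a ∈ Set.Icc (-1) 1) (ht : t ∈ Set.Icc (-1) 1) :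
    Real.cos (Real.arccos a + Real.arccos t) = a * t - √((1 - a ^ 2) * (1 - t ^ 2)) := by
  rw [Real.cos_add, Real.cos_arccos ha.1 ha.2, Real.cos_arccos ht.1 ht.2, Real.sin_arccos,
    Real.sin_arccos, Real.sqrt_mul (by nlinarith [ha.1, ha.2])]

theorem mFun_eq_cos_sq {a t : ℝ} (ha : a ∈ Set.Icc (-1) 1) (ht : t ∈ Set.Icc (-1) 1) :
    mFun a t = Real.cos (Real.arccos a + Real.arccos t) ^ 2 := by
  rw [mFun, cos_arccos_add_arccos ha ht]

theorem arccos_add_arccos_le_pi_div_two_iff {a t : ℝ} (ha : a ∈ Set.Icc 0 1)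
    (ht : t ∈ Set.Icc 0 1) :
    Real.arccos a + Real.arccos t ≤ Real.pi / 2 ↔ 1 - a ^ 2 ≤ t ^ 2 := by
  have hA := Real.arccos_le_pi_div_two.2 ha.1
  have hA0 := Real.arccos_nonneg a
  have hπ := Real.pi_pos
  calc Real.arccos a + Real.arccos t ≤ Real.pi / 2
      ↔ Real.arccos t ≤ Real.pi / 2 - Real.arccos a := by
        constructor <;> intro h <;> linarith
    _ ↔ Real.cos (Real.pi / 2 - Real.arccos a) ≤ Real.cos (Real.arccos t) :=
        (Real.strictAntiOn_cos.le_iff_ge ⟨by linarith, by linarith⟩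
          ⟨Real.arccos_nonneg t, Real.arccos_le_pi t⟩).symm
    _ ↔ 1 - a ^ 2 ≤ t ^ 2 := by
        rw [Real.cos_pi_div_two_sub, Real.sin_arccos,
          Real.cos_arccos (by linarith [ht.1]) ht.2, Real.sqrt_le_left ht.1]

theorem shrink_le_sq_iff {a b t : ℝ} (ha : a ∈ Set.Icc 0 1) (hb : b ≤ 1) (ht : t ∈ Set.Ico 0 1) :
    shrink a b ≤ t ^ 2 ↔ 1 - a ^ 2 ≤ t ^ 2 ∧ b ≤ mFun a t := by
  have hb' : √b ∈ Set.Icc 0 1 := ⟨Real.sqrt_nonneg b, Real.sqrt_le_one.2 hb⟩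
  set A := Real.arccos a
  set T := Real.arccos t
  set θ := Real.arccos √b
  have hA : A ∈ Set.Icc 0 (Real.pi / 2) :=
    ⟨Real.arccos_nonneg a, Real.arccos_le_pi_div_two.2 ha.1⟩
  have hT' : T ∈ Set.Ioc 0 (Real.pi / 2) :=
    ⟨Real.arccos_pos.2 ht.2, Real.arccos_le_pi_div_two.2 ht.1⟩
  have hθ' : θ ∈ Set.Icc 0 (Real.pi / 2) :=
    ⟨Real.arccos_nonneg _, Real.arccos_le_pi_div_two.2 hb'.1⟩
  have hcosT : Real.cos T = t := Real.cos_arccos (by linarith [ht.1]) ht.2.le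
  have hcosθ : Real.cos θ = √b := Real.cos_arccos (by linarith [hb'.1]) hb'.2
  have hφ : max (θ - A) 0 ∈ Set.Icc 0 (Real.pi / 2) :=
    ⟨le_max_right _ _, max_le (by linarith [hA.1, hθ'.2]) (by positivity)⟩
  have hanti : shrink a b ≤ t ^ 2 ↔ A + T ≤ θ := by
    rw [shrink, ← hcosT, pow_le_pow_iff_left₀ (Real.cos_nonneg_of_mem_Icc
      ⟨by linarith [hφ.1, Real.pi_pos], hφ.2⟩) (hcosT ▸ ht.1) two_ne_zero,
      Real.strictAntiOn_cos.le_iff_ge ⟨hφ.1, by linarith [hφ.2, Real.pi_pos]⟩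
      ⟨hT'.1.le, by linarith [hT'.2, Real.pi_pos]⟩, le_max_iff, or_iff_left hT'.1.not_ge,
      le_sub_iff_add_le, add_comm]
  have hcos (h : A + T ≤ Real.pi / 2) : A + T ≤ θ ↔ b ≤ mFun a t := by
    have h0 : 0 ≤ A + T := add_nonneg hA.1 hT'.1.le
    rw [mFun_eq_cos_sq ⟨by linarith [ha.1], ha.2⟩ ⟨by linarith [ht.1], ht.2.le⟩,
      ← Real.sqrt_le_left (Real.cos_nonneg_of_mem_Icc ⟨by linarith [Real.pi_pos], h⟩), ← hcosθ,
      Real.strictAntiOn_cos.le_iff_ge ⟨hθ'.1, by linarith [hθ'.2, Real.pi_pos]⟩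
      ⟨h0, by linarith [Real.pi_pos]⟩]
  rw [hanti, ← arccos_add_arccos_le_pi_div_two_iff ha ⟨ht.1, ht.2.le⟩]
  exact ⟨fun h => ⟨h.trans hθ'.2, (hcos (h.trans hθ'.2)).1 h⟩, fun h => (hcos h.1).2 h.2⟩

/-- The law of `w * shrink a b` for independent `w ∼ χ²_p` and `b ∼ beta(r / 2, (p - r) / 2)`. -/
noncomputable def critLaw (p r : ℕ) (a : ℝ) : Measure ℝ :=
  ((chiSq p).prod (betaHalf r p)).map fun x => x.1 * shrink a x.2

theorem measurable_mul_shrink (a : ℝ) : Measurable fun x : ℝ × ℝ => x.1 * shrink a x.2 :=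
  measurable_fst.mul ((continuous_shrink a).measurable.comp measurable_snd)

theorem isProbabilityMeasure_critLaw {p r : ℕ} (hr : 0 < r) (hrp : r ≤ p) (a : ℝ) :
    IsProbabilityMeasure (critLaw p r a) := by
  have := isProbabilityMeasure_chiSq (hr.trans_le hrp)
  have := isProbabilityMeasure_betaHalf hr hrp
  exact Measure.isProbabilityMeasure_map (measurable_mul_shrink a).aemeasurable

theorem critLaw_singleton {p r : ℕ} (hr : 0 < r) (hrp : r ≤ p) (a g : ℝ) :
    critLaw p r a {g} = 0 := by
  have := isProbabilityMeasure_chiSq (hr.trans_le hrp)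
  have := isProbabilityMeasure_betaHalf hr hrp
  have hm := measurable_mul_shrink a
  rw [critLaw, Measure.map_apply hm (measurableSet_singleton g),
    Measure.prod_apply_symm (hm (measurableSet_singleton g)),
    lintegral_eq_zero_iff (measurable_measure_prodMk_right (hm (measurableSet_singleton g)))]
  filter_upwards [ae_betaHalf_mem r p] with b hb
  refine chiSq_absolutelyContinuous p (measure_mono_null (t := {g / shrink a b}) (fun w hw => ?_)
    Real.volume_singleton)
  exact eq_div_of_mul_eq (shrink_pos a hb.1).ne' hw

theorem ae_critLaw_nonneg {p r : ℕ} (hr : 0 < r) (hrp : r ≤ p) (a : ℝ) :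
    ∀ᵐ g ∂(critLaw p r a), 0 ≤ g := by
  have := isProbabilityMeasure_chiSq (hr.trans_le hrp)
  have := isProbabilityMeasure_betaHalf hr hrp
  rw [critLaw, ae_map_iff (measurable_mul_shrink a).aemeasurable measurableSet_Ici]
  filter_upwards [Measure.quasiMeasurePreserving_fst.ae (ae_chiSq_nonneg p)] with x hx
  exact mul_nonneg hx (shrink_nonneg a x.2)

theorem cdf_eq_zero_of_ae_lt {μ : Measure ℝ} [IsProbabilityMeasure μ] {g : ℝ}
    (h : ∀ᵐ x ∂μ, g < x) : cdf μ g = 0 := by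
  have h0 : μ (Set.Iic g) = 0 := measure_eq_zero_iff_ae_notMem.2 (h.mono fun x hx => hx.not_ge)
  rw [cdf_eq_real, measureReal_def, h0, ENNReal.toReal_zero]

theorem chiSqDensity_of_neg (p : ℕ) {w : ℝ} (hw : w < 0) : chiSqDensity p w = 0 := by
  rw [chiSqDensity, gammaPDFReal, if_neg hw.not_ge]

theorem setIntegral_chiSq {p : ℕ} (hp : 0 < p) (f : ℝ → ℝ) {s : Set ℝ} (hs : MeasurableSet s) :
    ∫ w in s, f w ∂(chiSq p) = ∫ w in s, f w * chiSqDensity p w := by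
  rw [chiSq, gammaMeasure, setIntegral_withDensity_eq_setIntegral_toReal_smul
    (measurable_gammaPDF _ _) (ae_of_all _ fun _ => ENNReal.ofReal_lt_top) f hs]
  refine integral_congr_ae (ae_of_all _ fun w => ?_)
  have h : 0 ≤ gammaPDFReal ((p : ℝ) / 2) (1 / 2) w :=
    gammaPDFReal_nonneg (by positivity) (by norm_num) w
  simp only [gammaPDF, ENNReal.toReal_ofReal h, smul_eq_mul, mul_comm (f w), chiSqDensity]

theorem critCDF_of_neg {p r : ℕ} (hr : 0 < r) (hrp : r ≤ p) {a : ℝ} (ha : a ∈ Set.Icc 0 1)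
    {g : ℝ} (hg : g < 0) : critCDF p r a g = 0 := by
  have := isProbabilityMeasure_chiSq (hr.trans_le hrp)
  have := isProbabilityMeasure_betaHalf hr hrp
  rw [critCDF, cdf_eq_zero_of_ae_lt ((ae_chiSq_nonneg p).mono fun w hw => hg.trans_le hw), zero_add]
  split_ifs with h
  · refine setIntegral_eq_zero_of_forall_eq_zero fun w _ => ?_
    rcases lt_or_ge w 0 with hw | hw
    · rw [chiSqDensity_of_neg p hw, mul_zero]
    · have hm : mFun a √(g / w) = 0 := by
        simp [mFun, h, Real.sqrt_eq_zero_of_nonpos (div_nonpos_of_nonpos_of_nonneg hg.le hw)]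
      rw [hm, cdf_eq_zero_of_ae_lt ((ae_betaHalf_mem r p).mono fun b hb => hb.1), zero_mul]
  · have h1 : g / (1 - a ^ 2) < 0 :=
      div_neg_of_neg_of_pos hg (by nlinarith [ha.1, lt_of_le_of_ne ha.2 h])
    refine intervalIntegral.integral_zero_ae (ae_of_all _ fun w hw => ?_)
    rw [chiSqDensity_of_neg p (hw.2.trans_lt (max_lt hg h1)), mul_zero]

theorem critCDF_of_nonneg {a : ℝ} (ha : a ∈ Set.Icc 0 1) (p r : ℕ) {g : ℝ} (hg : 0 ≤ g) :
    critCDF p r a g = cdf (chiSq p) g +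
      ∫ w in Set.Ioi g ∩ {w | w * (1 - a ^ 2) ≤ g},
        cdf (betaHalf r p) (mFun a √(g / w)) * chiSqDensity p w := by
  rw [critCDF]
  split_ifs with h
  · simp [h, hg]
  · have ha2 : 0 < 1 - a ^ 2 := by nlinarith [ha.1, lt_of_le_of_ne ha.2 h]
    have hle : g ≤ g / (1 - a ^ 2) := by
      rw [le_div_iff₀ ha2]
      nlinarith [sq_nonneg a]
    rw [intervalIntegral.integral_of_le hle]
    simp only [← le_div_iff₀ ha2]
    rfl

theorem betaHalf_real_setOf_mul_shrink_le {p r : ℕ} (hr : 0 < r) (hrp : r ≤ p) {a : ℝ}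
    (ha : a ∈ Set.Icc 0 1) {g w : ℝ} (hg : 0 ≤ g) (hgw : g < w) :
    (betaHalf r p).real {b | w * shrink a b ≤ g} =
      if w * (1 - a ^ 2) ≤ g then cdf (betaHalf r p) (mFun a √(g / w)) else 0 := by
  have := isProbabilityMeasure_betaHalf hr hrp
  have hw : 0 < w := hg.trans_lt hgw
  have ht : √(g / w) ^ 2 = g / w := Real.sq_sqrt (by positivity)
  have ht1 : √(g / w) < 1 := by
    rwa [Real.sqrt_lt' one_pos, one_pow, div_lt_one hw]
  have hset : {b | w * shrink a b ≤ g} =ᵐ[betaHalf r p]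
      {b | w * (1 - a ^ 2) ≤ g ∧ b ≤ mFun a √(g / w)} := by
    filter_upwards [ae_betaHalf_mem r p] with b hb
    have h := shrink_le_sq_iff ha hb.2 ⟨Real.sqrt_nonneg (g / w), ht1⟩
    rw [ht, le_div_iff₀' hw, le_div_iff₀' hw] at h
    exact propext h
  rw [measureReal_congr hset]
  split_ifs with h <;> simp [h, cdf_eq_real, Set.Iic]

theorem integral_betaHalf_real_setOf_mul_shrink_le {p r : ℕ} (hr : 0 < r) (hrp : r ≤ p) {a : ℝ}
    (ha : a ∈ Set.Icc 0 1) {g : ℝ} (hg : 0 ≤ g) :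
    ∫ w, (betaHalf r p).real {b | w * shrink a b ≤ g} ∂(chiSq p) = critCDF p r a g := by
  have hp := hr.trans_le hrp
  have := isProbabilityMeasure_chiSq hp
  have := isProbabilityMeasure_betaHalf hr hrp
  have hint : Integrable (fun w => (betaHalf r p).real {b | w * shrink a b ≤ g}) (chiSq p) := by
    have hm := measurable_measure_prodMk_left (ν := betaHalf r p)
      (measurable_mul_shrink a (measurableSet_Iic (a := g)))
    exact Integrable.of_bound hm.ennreal_toReal.aestronglyMeasurable 1
      (ae_of_all _ fun w => by
        rw [Real.norm_of_nonneg measureReal_nonneg]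
        exact measureReal_le_one)
  have hle : ∀ᵐ w ∂(chiSq p), w ∈ Set.Iic g →
      (betaHalf r p).real {b | w * shrink a b ≤ g} = 1 := by
    filter_upwards [ae_chiSq_nonneg p] with w hw hwg
    have huniv : {b | w * shrink a b ≤ g} = Set.univ := Set.eq_univ_of_forall fun b =>
      (mul_le_of_le_one_right hw (shrink_le_one a b)).trans hwg
    rw [huniv, probReal_univ]
  have hgt : ∀ w ∈ Set.Ioi g, (betaHalf r p).real {b | w * shrink a b ≤ g} =
      {w | w * (1 - a ^ 2) ≤ g}.indicator
        (fun w => cdf (betaHalf r p) (mFun a √(g / w))) w := fun w hw =>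
    betaHalf_real_setOf_mul_shrink_le hr hrp ha hg hw
  have hset : MeasurableSet {w | w * (1 - a ^ 2) ≤ g} :=
    measurableSet_le (by fun_prop) measurable_const
  rw [critCDF_of_nonneg ha p r hg, ← integral_add_compl measurableSet_Iic hint, Set.compl_Iic,
    setIntegral_congr_ae measurableSet_Iic hle, setIntegral_congr_fun measurableSet_Ioi hgt,
    setIntegral_indicator hset, setIntegral_chiSq hp _ (measurableSet_Ioi.inter hset), cdf_eq_real,
    setIntegral_const, smul_eq_mul, mul_one]

theorem critLaw_real_Iic {p r : ℕ} (hr : 0 < r) (hrp : r ≤ p) {a : ℝ} (ha : a ∈ Set.Icc 0 1)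
    (g : ℝ) : (critLaw p r a).real (Set.Iic g) = critCDF p r a g := by
  have := isProbabilityMeasure_chiSq (hr.trans_le hrp)
  have := isProbabilityMeasure_betaHalf hr hrp
  have := isProbabilityMeasure_critLaw hr hrp a
  rcases lt_or_ge g 0 with hg | hg
  · rw [critCDF_of_neg hr hrp ha hg, ← cdf_eq_real]
    exact cdf_eq_zero_of_ae_lt ((ae_critLaw_nonneg hr hrp a).mono fun x hx => hg.trans_le hx)
  have hs := measurable_mul_shrink a (measurableSet_Iic (a := g))
  rw [← integral_betaHalf_real_setOf_mul_shrink_le hr hrp ha hg, measureReal_def, critLaw,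
    Measure.map_apply (measurable_mul_shrink a) measurableSet_Iic, Measure.prod_apply hs,
    ← integral_toReal (measurable_measure_prodMk_left hs).aemeasurable
      (ae_of_all _ fun _ => measure_lt_top _ _)]
  rfl

/-! ### The largest contrast over a cone around a subspace -/

section Cone

variable {E : Type*} [NormedAddCommGroup E] [InnerProductSpace ℝ E]
  (K : Submodule ℝ E) [K.HasOrthogonalProjection]

/-- The angle between a vector and a subspace, `π / 2` for the zero vector. -/
noncomputable def angleTo (z : E) : ℝ :=
  Real.arccos (‖K.starProjection z‖ / ‖z‖)

/-- The cone of the vectors at angle at most `arccos a` to the subspace `K`, in a form that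
includes the zero vector. -/
def coneAround (a : ℝ) : Set E :=
  {u | a * ‖u‖ ≤ ‖K.starProjection u‖}

/-- The largest value of `|⟪u, z⟫| / ‖u‖` over the nonzero `u` in `coneAround K a`, which is
attained in the plane of `z` and its projection to `K`, written as a function of the angle. -/
noncomputable def coneSup (a : ℝ) (z : E) : ℝ :=
  ‖z‖ * Real.cos (max (angleTo K z - Real.arccos a) 0)

theorem angleTo_nonneg (z : E) : 0 ≤ angleTo K z :=
  Real.arccos_nonneg _

theorem angleTo_le_pi_div_two (z : E) : angleTo K z ≤ Real.pi / 2 :=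
  Real.arccos_le_pi_div_two.2 (by positivity)

theorem norm_mul_cos_angleTo (z : E) : ‖z‖ * Real.cos (angleTo K z) = ‖K.starProjection z‖ := by
  have h0 : 0 ≤ ‖K.starProjection z‖ / ‖z‖ := by positivity
  rw [angleTo, Real.cos_arccos (by linarith)
    (div_le_one_of_le₀ (K.norm_starProjection_apply_le z) (norm_nonneg z))]
  refine mul_div_cancel_of_imp' fun hz => ?_
  rw [norm_eq_zero.1 hz, map_zero, norm_zero]

theorem norm_mul_sin_angleTo (z : E) : ‖z‖ * Real.sin (angleTo K z) = ‖Kᗮ.starProjection z‖ := by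
  have hsin : 0 ≤ Real.sin (angleTo K z) :=
    Real.sin_nonneg_of_nonneg_of_le_pi (angleTo_nonneg K z) (Real.arccos_le_pi _)
  rw [← sq_eq_sq₀ (by positivity) (norm_nonneg _), mul_pow, Real.sin_sq, mul_one_sub, ← mul_pow,
    norm_mul_cos_angleTo, K.norm_sq_eq_add_norm_sq_starProjection z, add_sub_cancel_left]

theorem inner_eq_inner_starProjection_add (u z : E) : inner ℝ u z =
    inner ℝ (K.starProjection u) (K.starProjection z) +
      inner ℝ (Kᗮ.starProjection u) (Kᗮ.starProjection z) := by
  rw [Submodule.inner_starProjection_left_eq_right, Submodule.inner_starProjection_left_eq_right,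
    ← inner_add_right, K.starProjection_eq_self_iff.2 (K.starProjection_apply_mem z),
    Kᗮ.starProjection_eq_self_iff.2 (Kᗮ.starProjection_apply_mem z),
    Submodule.starProjection_add_starProjection_orthogonal]

theorem abs_inner_le_mul_cos_sub_angleTo (u z : E) :
    |inner ℝ u z| ≤ ‖u‖ * ‖z‖ * Real.cos (angleTo K z - angleTo K u) :=
  calc |inner ℝ u z|
      ≤ ‖K.starProjection u‖ * ‖K.starProjection z‖ +
          ‖Kᗮ.starProjection u‖ * ‖Kᗮ.starProjection z‖ := by
        rw [inner_eq_inner_starProjection_add K]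
        exact (abs_add_le _ _).trans
          (add_le_add (abs_real_inner_le_norm _ _) (abs_real_inner_le_norm _ _))
    _ = ‖u‖ * ‖z‖ * Real.cos (angleTo K z - angleTo K u) := by
        simp only [← norm_mul_cos_angleTo K, ← norm_mul_sin_angleTo K, Real.cos_sub]
        ring

variable {K}

theorem angleTo_le_arccos_of_mem_coneAround {a : ℝ} {u : E} (hu : u ∈ coneAround K a)
    (hu0 : u ≠ 0) : angleTo K u ≤ Real.arccos a :=
  Real.arccos_le_arccos ((le_div_iff₀ (norm_pos_iff.2 hu0)).2 hu)

theorem abs_inner_le_coneSup_mul_norm {a : ℝ} {u : E} (hu : u ∈ coneAround K a) (z : E) :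
    |inner ℝ u z| ≤ coneSup K a z * ‖u‖ := by
  rcases eq_or_ne u 0 with rfl | hu0
  · simp
  have hangle : max (angleTo K z - Real.arccos a) 0 ≤ |angleTo K z - angleTo K u| :=
    max_le ((sub_le_sub_left (angleTo_le_arccos_of_mem_coneAround hu hu0) _).trans (le_abs_self _))
      (abs_nonneg _)
  have hpi : |angleTo K z - angleTo K u| ≤ Real.pi := by
    rw [abs_le]
    constructor <;> linarith [angleTo_nonneg K z, angleTo_nonneg K u, angleTo_le_pi_div_two K z,
      angleTo_le_pi_div_two K u, Real.pi_pos]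
  calc |inner ℝ u z| ≤ ‖u‖ * ‖z‖ * Real.cos |angleTo K z - angleTo K u| := by
        rw [Real.cos_abs]
        exact abs_inner_le_mul_cos_sub_angleTo K u z
    _ ≤ ‖u‖ * ‖z‖ * Real.cos (max (angleTo K z - Real.arccos a) 0) := by
        gcongr
        exact Real.cos_le_cos_of_nonneg_of_le_pi (le_max_right _ _) hpi hangle
    _ = coneSup K a z * ‖u‖ := by rw [coneSup]; ring

theorem exists_unit_mem_inner_eq_norm_starProjection (hK : K ≠ ⊥) (z : E) :
    ∃ e ∈ K, ‖e‖ = 1 ∧ inner ℝ e z = ‖K.starProjection z‖ := by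
  rcases eq_or_ne (K.starProjection z) 0 with h | h
  · obtain ⟨e, he, he0⟩ := K.exists_mem_ne_zero_of_ne_bot hK
    have hez : inner ℝ e z = 0 := by
      rw [← K.starProjection_eq_self_iff.2 he, Submodule.inner_starProjection_left_eq_right, h,
        inner_zero_right]
    exact ⟨‖e‖⁻¹ • e, K.smul_mem _ he, norm_smul_inv_norm he0, by
      rw [real_inner_smul_left, hez, mul_zero, h, norm_zero]⟩
  · refine ⟨‖K.starProjection z‖⁻¹ • K.starProjection z,
      K.smul_mem _ (K.starProjection_apply_mem z), norm_smul_inv_norm h, ?_⟩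
    have hinner : inner ℝ (K.starProjection z) z = ‖K.starProjection z‖ ^ 2 := by
      nth_rw 1 [← K.starProjection_eq_self_iff.2 (K.starProjection_apply_mem z)]
      rw [Submodule.inner_starProjection_left_eq_right, real_inner_self_eq_norm_sq]
    rw [real_inner_smul_left, hinner, pow_two, inv_mul_cancel_left₀ (norm_ne_zero_iff.2 h)]

theorem coneSup_le_norm (K : Submodule ℝ E) [K.HasOrthogonalProjection] (a : ℝ) (z : E) :
    coneSup K a z ≤ ‖z‖ :=
  mul_le_of_le_one_right (norm_nonneg z) (Real.cos_le_one _)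

theorem coneSup_eq_cos_mul_add_sin_mul (K : Submodule ℝ E) [K.HasOrthogonalProjection] (a : ℝ)
    (z : E) : coneSup K a z =
      Real.cos (min (Real.arccos a) (angleTo K z)) * ‖K.starProjection z‖ +
        Real.sin (min (Real.arccos a) (angleTo K z)) * ‖Kᗮ.starProjection z‖ := by
  have h : max (angleTo K z - Real.arccos a) 0 =
      angleTo K z - min (Real.arccos a) (angleTo K z) := by
    rcases le_total (Real.arccos a) (angleTo K z) with h | h <;> simp [h]
  rw [coneSup, h, Real.cos_sub, ← norm_mul_cos_angleTo, ← norm_mul_sin_angleTo]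
  ring

theorem le_cos_of_le_arccos {a φ : ℝ} (ha : a ≤ 1) (hφ0 : 0 ≤ φ) (hφ : φ ≤ Real.arccos a) :
    a ≤ Real.cos φ := by
  rcases le_total (-1) a with h | h
  · rw [← Real.cos_arccos h ha]
    exact Real.cos_le_cos_of_nonneg_of_le_pi hφ0 (Real.arccos_le_pi a) hφ
  · exact h.trans (Real.neg_one_le_cos φ)

theorem exists_mem_coneAround_inner_eq_coneSup (hK : K ≠ ⊥) {a : ℝ} (ha : a ≤ 1) (z : E) :
    ∃ u ∈ coneAround K a, ‖u‖ = 1 ∧ inner ℝ u z = coneSup K a z := by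
  obtain ⟨e, he, he1, hez⟩ := exists_unit_mem_inner_eq_norm_starProjection hK z
  rcases eq_or_ne Kᗮ ⊥ with hbot | hbot
  · have hecone : e ∈ coneAround K a := by
      rwa [coneAround, Set.mem_ofPred, K.starProjection_eq_self_iff.2 he, he1, mul_one]
    refine ⟨e, hecone, he1, le_antisymm ?_ ?_⟩
    · simpa [he1] using (le_abs_self _).trans (abs_inner_le_coneSup_mul_norm hecone z)
    · have hz : z ∈ K := (K.orthogonal_eq_bot_iff.1 hbot) ▸ Submodule.mem_top
      rw [hez, K.starProjection_eq_self_iff.2 hz]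
      exact coneSup_le_norm K a z
  obtain ⟨d, hd, hd1, hdz⟩ := exists_unit_mem_inner_eq_norm_starProjection hbot z
  set φ := min (Real.arccos a) (angleTo K z)
  have hφ0 : 0 ≤ φ := le_min (Real.arccos_nonneg a) (angleTo_nonneg K z)
  have hcos : 0 ≤ Real.cos φ := Real.cos_nonneg_of_mem_Icc
    ⟨by linarith [Real.pi_pos], (min_le_right _ _).trans (angleTo_le_pi_div_two K z)⟩
  have hu1 : ‖Real.cos φ • e + Real.sin φ • d‖ = 1 := by
    rw [← sq_eq_sq₀ (norm_nonneg _) zero_le_one, norm_add_sq_real, norm_smul, norm_smul, he1, hd1,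
      real_inner_smul_left, real_inner_smul_right, K.inner_right_of_mem_orthogonal he hd]
    simp
  have hPu : K.starProjection (Real.cos φ • e + Real.sin φ • d) = Real.cos φ • e := by
    rw [map_add, map_smul, map_smul, K.starProjection_eq_self_iff.2 he,
      K.starProjection_apply_eq_zero_iff.2 hd, smul_zero, add_zero]
  refine ⟨Real.cos φ • e + Real.sin φ • d, ?_, hu1, ?_⟩
  · rw [coneAround, Set.mem_ofPred, hu1, hPu, norm_smul, he1, mul_one, mul_one,
      Real.norm_of_nonneg hcos]
    exact le_cos_of_le_arccos ha hφ0 (min_le_left _ _)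
  · rw [coneSup_eq_cos_mul_add_sin_mul, inner_add_left, real_inner_smul_left,
      real_inner_smul_left, hez, hdz]

theorem forall_mem_coneAround_abs_inner_le_iff (hK : K ≠ ⊥) {a : ℝ} (ha : a ≤ 1) {z : E} {c : ℝ} :
    (∀ u ∈ coneAround K a, |inner ℝ u z| ≤ c * ‖u‖) ↔ coneSup K a z ≤ c := by
  refine ⟨fun h => ?_, fun h u hu => (abs_inner_le_coneSup_mul_norm hu z).trans (by gcongr)⟩
  obtain ⟨u, hu, hu1, huz⟩ := exists_mem_coneAround_inner_eq_coneSup hK ha z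
  simpa [hu1, huz] using (le_abs_self _).trans (h u hu)

theorem coneSup_nonneg (K : Submodule ℝ E) [K.HasOrthogonalProjection] (a : ℝ) (z : E) :
    0 ≤ coneSup K a z := by
  refine mul_nonneg (norm_nonneg z) (Real.cos_nonneg_of_mem_Icc ⟨?_, max_le ?_ (by positivity)⟩)
  · linarith [le_max_right (angleTo K z - Real.arccos a) 0, Real.pi_pos]
  · linarith [angleTo_le_pi_div_two K z, Real.arccos_nonneg a]

theorem lipschitzWith_coneSup (hK : K ≠ ⊥) {a : ℝ} (ha : a ≤ 1) :
    LipschitzWith 1 (coneSup K a) := by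
  refine LipschitzWith.of_le_add fun x y => ?_
  obtain ⟨u, hu, hu1, hux⟩ := exists_mem_coneAround_inner_eq_coneSup hK ha x
  calc coneSup K a x = inner ℝ u y + inner ℝ u (x - y) := by rw [← hux, inner_sub_right]; ring
    _ ≤ coneSup K a y + dist x y := by
      have hy := (le_abs_self _).trans (abs_inner_le_coneSup_mul_norm hu y)
      have hxy := real_inner_le_norm u (x - y)
      rw [hu1, mul_one] at hy
      rw [hu1, one_mul, ← dist_eq_norm] at hxy
      exact add_le_add hy hxy

theorem coneSup_apply_of_map_eq {L : Submodule ℝ E} [L.HasOrthogonalProjection] {f : E ≃ₗᵢ[ℝ] E}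
    (h : K.map (f.toLinearEquiv : E →ₗ[ℝ] E) = L) (a : ℝ) (z : E) :
    coneSup L a (f z) = coneSup K a z := by
  subst h
  simp only [coneSup, angleTo, Submodule.starProjection_map_apply, f.symm_apply_apply, f.norm_map]

theorem coneSup_sq (a : ℝ) (z : E) :
    coneSup K a z ^ 2 = ‖z‖ ^ 2 * shrink a (‖K.starProjection z‖ ^ 2 / ‖z‖ ^ 2) := by
  rw [coneSup, shrink, mul_pow, ← div_pow, Real.sqrt_sq (by positivity), angleTo]

theorem map_coneSup_sq_stdGaussian [FiniteDimensional ℝ E] [MeasurableSpace E] [BorelSpace E]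
    (hK : 0 < Module.finrank ℝ K) (a : ℝ) :
    (stdGaussian E).map (fun z => coneSup K a z ^ 2) =
      critLaw (Module.finrank ℝ E) (Module.finrank ℝ K) a := by
  rw [critLaw, ← map_norm_sq_div_stdGaussian hK,
    Measure.map_map (measurable_mul_shrink a) (by fun_prop)]
  simp only [coneSup_sq]
  rfl

end Cone

/-! ### Weak convergence -/

section WeakConvergence

variable {S T W ι : Type*} [TopologicalSpace S] [SecondCountableTopology S]
  [TopologicalSpace.PseudoMetrizableSpace S] [MeasurableSpace S] [BorelSpace S]
  [TopologicalSpace T] [SecondCountableTopology T] [TopologicalSpace.PseudoMetrizableSpace T]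
  [MeasurableSpace T] [BorelSpace T] [TopologicalSpace W] [MeasurableSpace W] [BorelSpace W]
  {f : S × T → W} {ν : ι → ProbabilityMeasure S} {γ : ProbabilityMeasure S} {l : Filter ι}

theorem tendsto_map_of_tendsto_parameter (hf : Continuous f) (hν : Tendsto ν l (𝓝 γ))
    {t : ι → T} {t₀ : T} (ht : Tendsto t l (𝓝 t₀)) :
    Tendsto (fun i => (ν i).map (hf.comp (.prodMk_left (t i))).measurable.aemeasurable) l
      (𝓝 (γ.map (hf.comp (.prodMk_left t₀)).measurable.aemeasurable)) := by
  have hmap (μ : ProbabilityMeasure S) (t : T) :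
      (μ.prod (diracProba t)).map hf.measurable.aemeasurable =
        μ.map (hf.comp (.prodMk_left t)).measurable.aemeasurable := by
    refine Subtype.ext ?_
    change Measure.map _ ((μ : Measure S).prod (Measure.dirac t)) = Measure.map _ _
    rw [Measure.prod_dirac, Measure.map_map hf.measurable (by fun_prop)]
  have hprod : Tendsto (fun i => (ν i).prod (diracProba (t i))) l (𝓝 (γ.prod (diracProba t₀))) :=
    (ProbabilityMeasure.continuous_prod.tendsto (γ, diracProba t₀)).comp
      (hν.prodMk_nhds ((continuous_diracProba.tendsto t₀).comp ht))
  simpa only [hmap] using ProbabilityMeasure.tendsto_map_of_tendsto_of_continuous _ _ hprod hf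

theorem tendsto_map_of_isCompact_parameter (hf : Continuous f) (hν : Tendsto ν l (𝓝 γ))
    {s : Set T} (hs : IsCompact s) {t : ι → T} (ht : ∀ i, t i ∈ s) {γ' : ProbabilityMeasure W}
    (hγ : ∀ t ∈ s, (γ : Measure S).map (fun x => f (x, t)) = γ') :
    Tendsto (fun i => (ν i).map (hf.comp (.prodMk_left (t i))).measurable.aemeasurable) l
      (𝓝 γ') := by
  refine tendsto_iff_ultrafilter _ _ _ |>.2 fun u hu => ?_
  obtain ⟨t₀, ht₀, hut⟩ := hs.ultrafilter_le_nhds (u.map t)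
    (tendsto_principal.2 (Eventually.of_forall ht))
  have hlim : γ' = γ.map (hf.comp (.prodMk_left t₀)).measurable.aemeasurable :=
    Subtype.ext (hγ t₀ ht₀).symm
  rw [hlim]
  exact tendsto_map_of_tendsto_parameter hf (hν.mono_left hu) hut

end WeakConvergence

theorem tendsto_real_setOf_le_of_tendstoInDistribution {ι : Type*} {l : Filter ι} {Ω : ι → Type*}
    {Ω' : Type*} [∀ i, MeasurableSpace (Ω i)] [MeasurableSpace Ω'] {P : ∀ i, Measure (Ω i)}
    [∀ i, IsProbabilityMeasure (P i)] {Q : Measure Ω'} [IsProbabilityMeasure Q]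
    {X : ∀ i, Ω i → ℝ} {Y : Ω' → ℝ} (hX : TendstoInDistribution X l Y P Q) {g : ℝ}
    (hg : Q.map Y {g} = 0) :
    Tendsto (fun i => (P i).real {ω | X i ω ≤ g}) l (𝓝 ((Q.map Y).real (Set.Iic g))) := by
  have := Measure.isProbabilityMeasure_map hX.aemeasurable_limit
  have hfrontier : Q.map Y (frontier (Set.Iic g)) = 0 := by
    rwa [frontier_Iic]
  have h := (ENNReal.tendsto_toReal (measure_ne_top (Q.map Y) (Set.Iic g))).comp
    (ProbabilityMeasure.tendsto_measure_of_null_frontier_of_tendsto' hX.tendsto hfrontier)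
  refine h.congr fun i => ?_
  rw [Function.comp_apply, ProbabilityMeasure.coe_mk,
    Measure.map_apply_of_aemeasurable (hX.forall_aemeasurable i) measurableSet_Iic]
  rfl

section Isometries

variable {E : Type*} [NormedAddCommGroup E] [InnerProductSpace ℝ E] [FiniteDimensional ℝ E]

theorem isCompact_setOf_forall_norm_apply_eq : IsCompact {A : E →L[ℝ] E | ∀ x, ‖A x‖ = ‖x‖} := by
  refine Metric.isCompact_of_isClosed_isBounded ?_ ?_
  · rw [Set.ofPred_forall]
    exact isClosed_iInter fun x => isClosed_eq (by fun_prop) continuous_const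
  · refine Metric.isBounded_closedBall (x := 0) (r := 1) |>.subset fun A hA => ?_
    rw [mem_closedBall_zero_iff]
    exact A.opNorm_le_bound zero_le_one fun x => by rw [hA x, one_mul]

theorem exists_linearIsometryEquiv_map_eq {K L : Submodule ℝ E}
    (h : Module.finrank ℝ K = Module.finrank ℝ L) :
    ∃ f : E ≃ₗᵢ[ℝ] E, K.map (f.toLinearEquiv : E →ₗ[ℝ] E) = L := by
  let e : K ≃ₗᵢ[ℝ] L := (stdOrthonormalBasis ℝ K).equiv (stdOrthonormalBasis ℝ L) (finCongr h)
  let g : K →ₗᵢ[ℝ] E := L.subtypeₗᵢ.comp e.toLinearIsometry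
  refine ⟨g.extend.toLinearIsometryEquiv rfl, Submodule.eq_of_le_of_finrank_eq ?_ ?_⟩
  · rintro - ⟨x, hx, rfl⟩
    have hgx : g.extend x = e ⟨x, hx⟩ := g.extend_apply ⟨x, hx⟩
    exact (congrArg (· ∈ L) hgx).mpr (e ⟨x, hx⟩).2
  · rw [LinearEquiv.finrank_map_eq, h]

theorem tendstoInDistribution_coneSup_sq [MeasurableSpace E] [BorelSpace E]
    {ι : Type*} {l : Filter ι} {Ω : ι → Type*} [∀ i, MeasurableSpace (Ω i)]
    {P : ∀ i, Measure (Ω i)} [∀ i, IsProbabilityMeasure (P i)]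
    {X : ∀ i, Ω i → E} (hX : TendstoInDistribution X l id P (stdGaussian E))
    {K : ι → Submodule ℝ E} {L : Submodule ℝ E} (hL : L ≠ ⊥)
    (hK : ∀ i, Module.finrank ℝ (K i) = Module.finrank ℝ L) {a : ℝ} (ha : a ≤ 1) :
    TendstoInDistribution (fun i ω => coneSup (K i) a (X i ω) ^ 2) l
      (fun z => coneSup L a z ^ 2) P (stdGaussian E) := by
  choose f hf using fun i => exists_linearIsometryEquiv_map_eq (hK i)
  have hcone : Continuous (coneSup L a) := (lipschitzWith_coneSup hL ha).continuous
  have hrot (i : ι) (z : E) : coneSup (K i) a z = coneSup L a (f i z) :=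
    (coneSup_apply_of_map_eq (hf i) a z).symm
  have hmeas (i : ι) : AEMeasurable (fun ω => coneSup (K i) a (X i ω) ^ 2) (P i) := by
    simp only [hrot]
    exact (by fun_prop : Measurable fun z => coneSup L a (f i z) ^ 2).comp_aemeasurable
      (hX.forall_aemeasurable i)
  refine ⟨hmeas, by fun_prop, ?_⟩
  let A (i : ι) : E →L[ℝ] E := (f i).toContinuousLinearEquiv
  have hF : Continuous fun x : E × (E →L[ℝ] E) => coneSup L a (x.2 x.1) ^ 2 := by fun_prop
  have hinv : ∀ B ∈ {B : E →L[ℝ] E | ∀ x, ‖B x‖ = ‖x‖},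
      (stdGaussian E).map (fun z => coneSup L a (B z) ^ 2) =
        (stdGaussian E).map fun z => coneSup L a z ^ 2 := fun B hB => by
    let B' : E ≃ₗᵢ[ℝ] E := LinearIsometry.toLinearIsometryEquiv ⟨B.toLinearMap, hB⟩ rfl
    have hB' : (stdGaussian E).map B = stdGaussian E := stdGaussian_map B'
    nth_rw 2 [← hB']
    rw [Measure.map_map (by fun_prop) (by fun_prop)]
    rfl
  have hlim := hX.tendsto
  simp only [Measure.map_id] at hlim
  have h := tendsto_map_of_isCompact_parameter hF hlim isCompact_setOf_forall_norm_apply_eq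
    (t := A) (fun i => (f i).norm_map)
    (γ' := ⟨_, Measure.isProbabilityMeasure_map (by fun_prop)⟩) hinv
  refine h.congr fun i => Subtype.ext ?_
  simp only [hrot]
  exact AEMeasurable.map_map_of_aemeasurable (by fun_prop) (hX.forall_aemeasurable i)

end Isometries

/-! ### Standardizing the bands -/

section ColumnSpace

variable {m n : Type*} [Fintype n] [DecidableEq n]

/-- The span of the columns of `V`, as a subspace of a Euclidean space. -/
noncomputable def colSpace (V : Matrix m n ℝ) : Submodule ℝ (EuclideanSpace ℝ m) :=
  LinearMap.range (toLpLin 2 2 V)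

theorem toLpLin_injective {V : Matrix m n ℝ} (hV : LinearIndependent ℝ V.col) :
    Function.Injective (toLpLin 2 2 V) :=
  (WithLp.toLp_injective 2).comp ((mulVec_injective_iff.2 hV).comp (WithLp.ofLp_injective 2))

theorem finrank_colSpace {V : Matrix m n ℝ} (hV : LinearIndependent ℝ V.col) :
    Module.finrank ℝ (colSpace V) = Fintype.card n := by
  rw [colSpace, LinearMap.finrank_range_of_inj (toLpLin_injective hV), finrank_euclideanSpace]

theorem colSpace_ne_bot [Nonempty n] {V : Matrix m n ℝ} (hV : LinearIndependent ℝ V.col) :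
    colSpace V ≠ ⊥ := by
  intro hbot
  have hcard := finrank_colSpace hV
  rw [hbot, finrank_bot] at hcard
  exact Fintype.card_ne_zero hcard.symm

theorem starProjection_colSpace [Fintype m] {V : Matrix m n ℝ} (hV : LinearIndependent ℝ V.col)
    (z : m → ℝ) :
    (colSpace V).starProjection (WithLp.toLp 2 z) =
      WithLp.toLp 2 (V *ᵥ ((Vᵀ * V)⁻¹ *ᵥ (Vᵀ *ᵥ z))) := by
  have hunit : IsUnit (Vᵀ * V).det := by
    rw [← isUnit_iff_isUnit_det, ← conjTranspose_eq_transpose_of_trivial]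
    exact (PosDef.conjTranspose_mul_self V (mulVec_injective_iff.2 hV)).isUnit
  refine Submodule.eq_starProjection_of_mem_of_inner_eq_zero
    ⟨WithLp.toLp 2 ((Vᵀ * V)⁻¹ *ᵥ (Vᵀ *ᵥ z)), rfl⟩ ?_
  rintro - ⟨w, rfl⟩
  have hnormal : Vᵀ *ᵥ (V *ᵥ ((Vᵀ * V)⁻¹ *ᵥ (Vᵀ *ᵥ z))) = Vᵀ *ᵥ z := by
    rw [mulVec_mulVec, mulVec_mulVec, mul_nonsing_inv _ hunit, one_mulVec]
  rw [toLpLin_apply, ← WithLp.toLp_sub, EuclideanSpace.inner_toLp_toLp, star_trivial,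
    dotProduct_comm, dotProduct_mulVec, ← mulVec_transpose, mulVec_sub, hnormal, sub_self,
    zero_dotProduct]

end ColumnSpace

theorem linearIndependent_col_nonsing_inv_mul {m n : Type*} [Fintype m] [DecidableEq m]
    [Finite n] {R : Matrix m m ℝ} (hR : IsUnit R.det) {Z : Matrix m n ℝ}
    (hZ : LinearIndependent ℝ Z.col) : LinearIndependent ℝ (R⁻¹ * Z).col := by
  have := Fintype.ofFinite n
  rw [← mulVec_injective_iff] at hZ ⊢
  have hcomp : (R⁻¹ * Z).mulVec = (R⁻¹).mulVec ∘ Z.mulVec :=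
    funext fun x => (mulVec_mulVec x R⁻¹ Z).symm
  rw [hcomp]
  exact (mulVec_injective_of_isUnit ((isUnit_nonsing_inv_iff).2
    ((isUnit_iff_isUnit_det R).2 hR))).comp hZ

section SquareRoot

variable {m : Type*} [Fintype m] [DecidableEq m]

theorem transpose_sqrt (F : Matrix m m ℝ) : (CFC.sqrt F)ᵀ = CFC.sqrt F := by
  rw [← conjTranspose_eq_transpose_of_trivial]
  exact (nonneg_iff_posSemidef.1 (CFC.sqrt_nonneg F)).isHermitian

theorem sqrt_mul_transpose_sqrt {F : Matrix m m ℝ} (hF : F.PosSemidef) :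
    CFC.sqrt F * (CFC.sqrt F)ᵀ = F := by
  rw [transpose_sqrt, CFC.sqrt_mul_sqrt_self F hF.nonneg]

theorem isUnit_det_sqrt {F : Matrix m m ℝ} (hF : F.PosDef) :
    IsUnit (CFC.sqrt F).det := by
  have h := (isUnit_iff_isUnit_det F).1 hF.isUnit
  rw [← sqrt_mul_transpose_sqrt hF.posSemidef, det_mul] at h
  exact isUnit_of_mul_isUnit_left h

end SquareRoot

section Bands

variable {p r : ℕ} {R : Matrix (Fin p) (Fin p) ℝ} {Z : Matrix (Fin p) (Fin r) ℝ}

theorem quadInv_mul_transpose (R : Matrix (Fin p) (Fin p) ℝ) (x : Fin p → ℝ) :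
    quadInv (R * Rᵀ) x = ‖WithLp.toLp 2 (R⁻¹ *ᵥ x)‖ ^ 2 := by
  rw [← real_inner_self_eq_norm_sq, EuclideanSpace.inner_toLp_toLp, star_trivial, quadInv,
    Matrix.mul_inv_rev, ← mulVec_mulVec, ← transpose_nonsing_inv, dotProduct_transpose_mulVec]

theorem quadProj_mul_transpose (hZ : LinearIndependent ℝ (R⁻¹ * Z).col) (x : Fin p → ℝ) :
    quadProj (R * Rᵀ) Z x =
      ‖(colSpace (R⁻¹ * Z)).starProjection (WithLp.toLp 2 (R⁻¹ *ᵥ x))‖ ^ 2 := by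
  have hgram : (R⁻¹ * Z)ᵀ * (R⁻¹ * Z) = Zᵀ * (R * Rᵀ)⁻¹ * Z := by
    rw [transpose_mul, transpose_nonsing_inv, Matrix.mul_inv_rev]
    simp only [Matrix.mul_assoc]
  rw [← real_inner_self_eq_norm_sq, Submodule.inner_starProjection_left_eq_right,
    Submodule.starProjection_eq_self_iff.2 (Submodule.starProjection_apply_mem _ _),
    starProjection_colSpace hZ, EuclideanSpace.inner_toLp_toLp, star_trivial,
    ← dotProduct_transpose_mulVec (R⁻¹), hgram, quadProj]
  simp only [Matrix.mul_inv_rev R, mulVec_mulVec, transpose_mul, transpose_nonsing_inv,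
    Matrix.mul_assoc]

theorem mem_region_iff_mem_coneAround (hZ : LinearIndependent ℝ (R⁻¹ * Z).col) {a : ℝ}
    (ha : 0 ≤ a) {x : Fin p → ℝ} :
    x ∈ region (R * Rᵀ) Z a ↔ WithLp.toLp 2 (R⁻¹ *ᵥ x) ∈ coneAround (colSpace (R⁻¹ * Z)) a := by
  rw [region, Set.mem_ofPred, quadInv_mul_transpose, quadProj_mul_transpose hZ, ← mul_pow,
    sq_le_sq₀ (by positivity) (norm_nonneg _)]
  rfl

theorem dotProduct_mem_Icc_iff_abs_inner_le (hR : IsUnit R.det) {c : ℝ} {β b x : Fin p → ℝ} :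
    x ⬝ᵥ β ∈ Set.Icc (x ⬝ᵥ b - c * √(quadInv (R * Rᵀ) x)) (x ⬝ᵥ b + c * √(quadInv (R * Rᵀ) x)) ↔
      |inner ℝ (WithLp.toLp 2 (R⁻¹ *ᵥ x)) (WithLp.toLp 2 (Rᵀ *ᵥ (b - β)))| ≤
        c * ‖WithLp.toLp 2 (R⁻¹ *ᵥ x)‖ := by
  have hinner : inner ℝ (WithLp.toLp 2 (R⁻¹ *ᵥ x)) (WithLp.toLp 2 (Rᵀ *ᵥ (b - β))) =
      x ⬝ᵥ b - x ⬝ᵥ β := by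
    rw [EuclideanSpace.inner_toLp_toLp, star_trivial, mulVec_transpose, ← dotProduct_mulVec,
      mulVec_mulVec, mul_nonsing_inv _ hR, one_mulVec, dotProduct_comm, dotProduct_sub]
  rw [hinner, quadInv_mul_transpose, Real.sqrt_sq (norm_nonneg _), abs_le, Set.mem_Icc]
  constructor <;> rintro ⟨hl, hu⟩ <;> constructor <;> linarith

theorem linearBandCovers_iff_coneSup_le (hr : 0 < r) (hR : IsUnit R.det)
    (hZ : LinearIndependent ℝ Z.col) {a : ℝ} (ha : a ∈ Set.Icc 0 1) {c : ℝ} {β b : Fin p → ℝ} :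
    LinearBandCovers (R * Rᵀ) (region (R * Rᵀ) Z a) c β b ↔
      coneSup (colSpace (R⁻¹ * Z)) a (WithLp.toLp 2 (Rᵀ *ᵥ (b - β))) ≤ c := by
  have hRZ := linearIndependent_col_nonsing_inv_mul hR hZ
  have := Fin.pos_iff_nonempty.1 hr
  have hsurj : Function.Surjective fun x : Fin p → ℝ => WithLp.toLp 2 (R⁻¹ *ᵥ x) := fun u =>
    ⟨R *ᵥ u.ofLp, by simp only [mulVec_mulVec, nonsing_inv_mul _ hR, one_mulVec]⟩
  rw [← forall_mem_coneAround_abs_inner_le_iff (colSpace_ne_bot hRZ) ha.2, hsurj.forall]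
  refine forall_congr' fun x => ?_
  rw [mem_region_iff_mem_coneAround hRZ ha.1, dotProduct_mem_Icc_iff_abs_inner_le hR]

theorem probBandCovers_iff_linearBandCovers {F : Matrix (Fin p) (Fin p) ℝ} {S : Set (Fin p → ℝ)}
    {c : ℝ} {β b : Fin p → ℝ} : ProbBandCovers F S c β b ↔ LinearBandCovers F S c β b := by
  have hmono (s t : ℝ) : (1 + Real.exp s)⁻¹ ≤ (1 + Real.exp t)⁻¹ ↔ t ≤ s := by
    rw [inv_le_inv₀ (by positivity) (by positivity), add_le_add_iff_left, Real.exp_le_exp]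
  refine forall₂_congr fun x _ => ?_
  rw [responseProb, one_div, Set.mem_Icc, Set.mem_Icc, hmono, hmono]
  constructor <;> rintro ⟨hl, hu⟩ <;> constructor <;> linarith

theorem map_coneSup_colSpace_sq_stdGaussian (hr : 0 < r) (hZ : LinearIndependent ℝ Z.col) (a : ℝ) :
    (stdGaussian (EuclideanSpace ℝ (Fin p))).map (fun z => coneSup (colSpace Z) a z ^ 2) =
      critLaw p r a := by
  have hrank : Module.finrank ℝ (colSpace Z) = r := by rw [finrank_colSpace hZ, Fintype.card_fin]
  rw [map_coneSup_sq_stdGaussian (hrank.symm ▸ hr), hrank, finrank_euclideanSpace_fin]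

theorem tendsto_real_linearBandCovers (hr : 0 < r) (hZ : LinearIndependent ℝ Z.col) {a c : ℝ}
    (ha : a ∈ Set.Icc 0 1) (hc : 0 ≤ c) {Ω : ℕ → Type*} [∀ n, MeasurableSpace (Ω n)]
    {P : ∀ n, Measure (Ω n)} [∀ n, IsProbabilityMeasure (P n)] {β : Fin p → ℝ}
    {F : ℕ → Matrix (Fin p) (Fin p) ℝ} {est : ∀ n, Ω n → Fin p → ℝ}
    (h : IsAsympNormal P β F est) :
    Tendsto (fun n => (P n).real {ω | LinearBandCovers (F n) (region (F n) Z a) c β (est n ω)})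
      atTop (𝓝 ((critLaw p r a).real (Set.Iic (c ^ 2)))) := by
  classical
  obtain ⟨hpos, hdist⟩ := h
  let V (n : ℕ) : Matrix (Fin p) (Fin r) ℝ := if (F n).PosDef then (CFC.sqrt (F n))⁻¹ * Z else Z
  have hV (n : ℕ) : LinearIndependent ℝ (V n).col := by
    by_cases hn : (F n).PosDef
    · rw [show V n = _ from if_pos hn]
      exact linearIndependent_col_nonsing_inv_mul (isUnit_det_sqrt hn) hZ
    · rwa [show V n = _ from if_neg hn]
  have := Fin.pos_iff_nonempty.1 hr
  have hrp : r ≤ p := by simpa using hZ.fintype_card_le_finrank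
  have hlaw := map_coneSup_colSpace_sq_stdGaussian hr hZ a
  have hlim := tendsto_real_setOf_le_of_tendstoInDistribution
    (tendstoInDistribution_coneSup_sq hdist (colSpace_ne_bot hZ)
      (fun n => (finrank_colSpace (hV n)).trans (finrank_colSpace hZ).symm) ha.2)
    (hlaw ▸ critLaw_singleton hr hrp a (c ^ 2))
  rw [hlaw] at hlim
  refine hlim.congr' ?_
  filter_upwards [hpos] with n hn
  simp only [show V n = _ from if_pos hn, sq_le_sq₀ (coneSup_nonneg _ _ _) hc]
  congr 1
  ext ω
  have hcover := linearBandCovers_iff_coneSup_le hr (isUnit_det_sqrt hn) hZ ha (c := c) (β := β)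
    (b := est n ω)
  rw [sqrt_mul_transpose_sqrt hn.posSemidef, transpose_sqrt] at hcover
  exact hcover.symm

end Bands

end LogisticBand

theorem theorem1_general {p r : ℕ} (hr : 1 ≤ r)
    (Z : Matrix (Fin p) (Fin r) ℝ) (hZ : LinearIndependent ℝ Z.col)
    (a : ℝ) (ha0 : 0 ≤ a) (ha1 : a ≤ 1)
    {Ω : ℕ → Type*} [∀ n, MeasurableSpace (Ω n)]
    (P : ∀ n, Measure (Ω n)) [∀ n, IsProbabilityMeasure (P n)]
    (β : Fin p → ℝ) (F : ℕ → Matrix (Fin p) (Fin p) ℝ) (est : ∀ n, Ω n → Fin p → ℝ)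
    (hnormal : IsAsympNormal P β F est) :
    ∃ G : Measure ℝ, IsProbabilityMeasure G ∧
      (∀ g : ℝ, G.real (Set.Iic g) = critCDF p r a g) ∧
      ∀ c : ℝ, 0 ≤ c →
        Tendsto (fun n => (P n).real
            {ω | LinearBandCovers (F n) (region (F n) Z a) c β (est n ω)})
          atTop (𝓝 (G.real (Set.Iic (c ^ 2)))) ∧
        Tendsto (fun n => (P n).real
            {ω | ProbBandCovers (F n) (region (F n) Z a) c β (est n ω)})
          atTop (𝓝 (G.real (Set.Iic (c ^ 2)))) := by
  have hrp : r ≤ p := by simpa using hZ.fintype_card_le_finrank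
  refine ⟨critLaw p r a, isProbabilityMeasure_critLaw hr hrp a,
    critLaw_real_Iic hr hrp ⟨ha0, ha1⟩, fun c hc => ?_⟩
  simp only [probBandCovers_iff_linearBandCovers, and_self]
  exact tendsto_real_linearBandCovers hr hZ ⟨ha0, ha1⟩ hc hnormal

theorem theorem1 {p r : ℕ} (hr : 1 ≤ r) (hrp : r ≤ p)
    (Z : Matrix (Fin p) (Fin r) ℝ) (hZ : LinearIndependent ℝ Z.col)
    (a : ℝ) (ha0 : 0 ≤ a) (ha1 : a ≤ 1)
    {Ω : ℕ → Type*} [∀ n, MeasurableSpace (Ω n)]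
    (P : ∀ n, Measure (Ω n)) [∀ n, IsProbabilityMeasure (P n)]
    (β : Fin p → ℝ)
    (X : ∀ n, Fin n → Fin p → ℝ) (Y : ∀ n, Fin n → Ω n → ℝ)
    (hY : ∀ n, IsLogisticSample (P n) β (X n) (Y n))
    (F : ℕ → Matrix (Fin p) (Fin p) ℝ)
    (hF : ∀ n, F n = fisherInfo (P n) β (X n) (Y n))
    (est : ∀ n, Ω n → Fin p → ℝ) (hest : ∀ n, IsMLE (X n) (Y n) (est n))
    (hnormal : IsAsympNormal P β F est) :
    ∃ G : Measure ℝ, IsProbabilityMeasure G ∧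
      (∀ g : ℝ, G.real (Set.Iic g) = critCDF p r a g) ∧
      ∀ α c : ℝ, 0 < α → α < 1 → 0 ≤ c → G.real (Set.Iic (c ^ 2)) = 1 - α →
        Tendsto (fun n => (P n).real
            {ω | LinearBandCovers (F n) (region (F n) Z a) c β (est n ω)})
          atTop (𝓝 (1 - α)) ∧
        Tendsto (fun n => (P n).real
            {ω | ProbBandCovers (F n) (region (F n) Z a) c β (est n ω)})
          atTop (𝓝 (1 - α)) := by
  obtain ⟨G, hG, hcdf, hlim⟩ := theorem1_general hr Z hZ a ha0 ha1 P β F est hnormal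
  exact ⟨G, hG, hcdf, fun α c _ _ hc hα => hα ▸ hlim c hc⟩
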